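/- Let $1\le j<i\le N$ and $1\le k\le N-1$, let $T\ge 1$, $d_1,\dots,d_N>0$, $\gamma\in\mathbb{R}$ and $\sigma>0$. Let ${\bf g}_1,\dots,{\bf g}_N$ be mutually independent random vectors in $\mathbb{C}^T$ with law $\mathcal{CN}(0,{\bf I})$ (independent coordinates, each with independent real and imaginary parts of law $\mathcal N(0,1/2)$), and let ${\bf h}_u=\sqrt{d_u^{-\gamma}}\,{\bf g}_u$ be the corresponding Rayleigh-faded channels. Let ${\bf W}=[{\bf w}_1,\dots,{\bf w}_N]$ be a random complex $T\times N$ matrix, of arbitrary law, with ${\bf W}^{H}{\bf W}={\bf I}$ almost surely, independent of $({\bf g}_1,\dots,{\bf g}_N)$. Put $$\mathrm{SINR}_u^k=\frac{|{\bf h}_u^{H}{\bf w}_k|^2}{\sum_{m=k+1}^N|{\bf h}_u^{H}{\bf w}_m|^2+\sigma^2},\qquad \lambda_u=d_u^{\gamma}\qquad(1\le u\le N).$$ Then $$\Pr\left(\mathrm{SINR}_i^k>\mathrm{SINR}_j^k\right)=1-e^{(\lambda_i+\lambda_j)\sigma^2}\lambda_i\sigma^2\,\psi\big((\lambda_i+\lambda_j)\sigma^2,\,2(N-k)\big)-e^{(\lambda_i+\lambda_j)\sigma^2}(N-k)\,\psi\big((\lambda_i+\lambda_j)\sigma^2,\,2(N-k)+1\big),$$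 where, for $\lambda>0$ and integers $m\ge 2$, $$\psi(\lambda,m)=(-1)^m\frac{\lambda^{m-1}\,\mathrm{Ei}(-\lambda)}{(m-1)!}+e^{-\lambda}\sum_{l=0}^{m-2}\frac{(-1)^l\lambda^l}{(m-1)(m-2)\cdots(m-1-l)},$$ and $\mathrm{Ei}$ is the exponential integral, $\mathrm{Ei}(x)=-\,\mathrm{p.v.}\!\int_{-x}^{\infty}\frac{e^{-t}}{t}\,dt$ for $x\neq 0$. -/

import Mathlib

open MeasureTheory ProbabilityTheory Filter Topology
open scoped Matrix

noncomputable section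

/-- The exponential integral `Ei x = - p.v. ∫_{-x}^∞ e^{-t}/t dt` for real `x ≠ 0`: the Cauchy
principal value at the singularity `t = 0` (which matters for `x > 0` only). -/
def Ei (x : ℝ) : ℝ :=
  limUnder (𝓝[>] (0 : ℝ)) fun ε : ℝ => -∫ t in {t : ℝ | -x < t ∧ ε < |t|}, Real.exp (-t) / t

/-- At negative arguments no principal value is needed. -/
theorem Ei_of_neg {x : ℝ} (hx : x < 0) :
    Ei x = -∫ t in Set.Ioi (-x), Real.exp (-t) / t := by
  refine Tendsto.limUnder_eq (tendsto_const_nhds.congr' ?_)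
  filter_upwards [Ioo_mem_nhdsGT (neg_pos.mpr hx)] with ε hε
  have hset : {t : ℝ | -x < t ∧ ε < |t|} = Set.Ioi (-x) := by
    ext t
    refine ⟨fun ht => ht.1, fun ht => ⟨ht, ?_⟩⟩
    rw [Set.mem_Ioi] at ht
    exact (hε.2.trans ht).trans_le (le_abs_self t)
  rw [hset]

/-- `ψ(μ, m) = (-1)^m μ^(m-1) Ei(-μ) / (m-1)!
  + e^(-μ) ∑_{l=0}^{m-2} (-1)^l μ^l / ((m-1)(m-2)⋯(m-1-l))`, for `μ > 0` and `m ≥ 1`. -/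
def psi (μ : ℝ) (m : ℕ) : ℝ :=
  (-1) ^ m * (μ ^ (m - 1) * Ei (-μ)) / ((m - 1).factorial : ℝ)
    + Real.exp (-μ) * ∑ l ∈ Finset.range (m - 1),
        (-1) ^ l * μ ^ l / ∏ r ∈ Finset.range (l + 1), ((m : ℝ) - 1 - (r : ℝ))

/-- The circularly symmetric complex Gaussian law `CN(0, 1)` on `ℂ`: real and imaginary part are
independent real Gaussians with mean `0` and variance `1/2`. -/
def stdComplexGaussian : Measure ℂ :=
  ((gaussianReal 0 (1 / 2)).prod (gaussianReal 0 (1 / 2))).map Complex.measurableEquivRealProd.symm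

/-- The law `CN(0, I)` on `ℂ^T`: the coordinates are independent with law `CN(0, 1)`. -/
def stdComplexGaussianVec (T : ℕ) : Measure (Fin T → ℂ) :=
  Measure.pi fun _ => stdComplexGaussian

/-- The σ-algebra on matrices generated by the entries. -/
instance matrixMeasurableSpace (T N : ℕ) : MeasurableSpace (Matrix (Fin T) (Fin N) ℂ) :=
  inferInstanceAs (MeasurableSpace (Fin T → Fin N → ℂ))

/-- The channel vectors `h_i = √(d_i^(-γ)) g_i`, with distances `d_i` and path loss exponent `γ`. -/
def channel {N T : ℕ} (d : Fin N → ℝ) (γ : ℝ) (g : Fin N → Fin T → ℂ) (i : Fin N) : Fin T → ℂ :=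
  fun t => (Real.sqrt (d i ^ (-γ)) : ℂ) * g i t

/-- `SINR_i^k = |h_iᴴ w_k|² / (∑_{m > k} |h_iᴴ w_m|² + σ²)`, where `w_m` is the `m`-th column of the
precoding matrix `W`. -/
def sinr {N T : ℕ} (h : Fin N → Fin T → ℂ) (W : Matrix (Fin T) (Fin N) ℂ) (σ : ℝ)
    (i k : Fin N) : ℝ :=
  ‖star (h i) ⬝ᵥ W.col k‖ ^ 2 / (∑ m ∈ Finset.Ioi k, ‖star (h i) ⬝ᵥ W.col m‖ ^ 2 + σ ^ 2)

end

/-!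
For a fixed matrix `w` with orthonormal columns, unitary invariance of the complex Gaussian law
(checked on characteristic functions, `map_star_dotProduct_col_stdComplexGaussianVec`) makes the
inner products `gᴴ w_m` of a user's vector `g` with the columns independent with law `CN(0, 1)`.
Their squared moduli are exponential with rate one. Conditioning on the interference, the SINR of
user `u` therefore has the tail `e^(-λ_u σ² x) (1 + x)^(-n)`, where `n` is the number of interfering
columns (`stdComplexGaussianVec_lt_gainRatio`).

The SINRs of two different users are independent for fixed `w`. Writing `q` for the density of
`SINR_i`, Fubini and the layer cake formula give
`Pr (SINR_i > SINR_j) = 1 - E ∫₀^(SINR_j) q = 1 - ∫₀^∞ Pr (SINR_j > x) q x dx`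
(`prod_real_lt_of_tails`). With `s = (λ_i + λ_j) σ²`, the last integral is a combination of the
integrals `∫₀^∞ e^(-s x) (1 + x)^(-m) dx` for `m = 2 n` and `m = 2 n + 1`, and these equal
`e^s ψ(s, m)`: both sides satisfy the same recursion in `m`, and agree at `m = 1` by the definition
of `Ei` (`integral_exp_neg_mul_div_pow`).

Since the answer is the same for every `w`, and the precoding matrix is independent of the Gaussian
vectors, it is also the unconditional probability (`IndepFun.measureReal_of_sections`).
-/

open scoped ENNReal

/-! ### The exponential integrals `ψ` -/

lemma psi_one (s : ℝ) : psi s 1 = -Ei (-s) := by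
  simp [psi]

/-- The recursion `m ψ(s, m + 1) = e^(-s) - s ψ(s, m)` of the generalized exponential integrals. -/
lemma mul_psi_succ (s : ℝ) {m : ℕ} (hm : 1 ≤ m) :
    (m : ℝ) * psi s (m + 1) = Real.exp (-s) - s * psi s m := by
  obtain ⟨n, rfl⟩ : ∃ n, m = n + 1 := ⟨m - 1, by omega⟩
  have hn : ((n : ℝ) + 1) ≠ 0 := by positivity
  have hfac : (n.factorial : ℝ) ≠ 0 := by positivity
  have hsum : ((n : ℝ) + 1) * ∑ l ∈ Finset.range (n + 1),
        (-1) ^ l * s ^ l / ∏ r ∈ Finset.range (l + 1), (((n + 1 + 1 : ℕ) : ℝ) - 1 - (r : ℝ))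
      = 1 - s * ∑ l ∈ Finset.range n,
        (-1) ^ l * s ^ l / ∏ r ∈ Finset.range (l + 1), (((n + 1 : ℕ) : ℝ) - 1 - (r : ℝ)) := by
    rw [Finset.sum_range_succ', mul_add, Finset.mul_sum, Finset.mul_sum]
    have h0 : ((n : ℝ) + 1) * ((-1) ^ 0 * s ^ 0 /
        ∏ r ∈ Finset.range (0 + 1), (((n + 1 + 1 : ℕ) : ℝ) - 1 - (r : ℝ))) = 1 := by
      simp [hn]
    rw [h0, add_comm, sub_eq_add_neg (1 : ℝ), ← Finset.sum_neg_distrib]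
    congr 1
    refine Finset.sum_congr rfl fun l _ => ?_
    rw [Finset.prod_range_succ' _ (l + 1)]
    have hprod : ∏ r ∈ Finset.range (l + 1), (((n + 1 + 1 : ℕ) : ℝ) - 1 - ((r + 1 : ℕ) : ℝ))
        = ∏ r ∈ Finset.range (l + 1), (((n + 1 : ℕ) : ℝ) - 1 - (r : ℝ)) :=
      Finset.prod_congr rfl fun r _ => by push_cast; ring
    have hlast : ((n + 1 + 1 : ℕ) : ℝ) - 1 - ((0 : ℕ) : ℝ) = (n : ℝ) + 1 := by push_cast; ring
    rw [hprod, hlast, pow_succ, pow_succ, mul_comm (∏ r ∈ _, _) ((n : ℝ) + 1), ← mul_div_assoc,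
      mul_div_mul_left _ _ hn]
    ring
  unfold psi
  simp only [Nat.add_sub_cancel, Nat.factorial_succ]
  push_cast at hsum ⊢
  rw [mul_add, mul_left_comm _ (Real.exp (-s)), hsum]
  field_simp
  ring

lemma integrableOn_exp_neg_mul_div_pow {s : ℝ} (hs : 0 < s) (m : ℕ) :
    IntegrableOn (fun x : ℝ => Real.exp (-s * x) / (1 + x) ^ m) (Set.Ioi 0) := by
  refine Integrable.mono' (exp_neg_integrableOn_Ioi 0 hs)
    (by fun_prop : Measurable _).aestronglyMeasurable ?_
  filter_upwards [ae_restrict_mem measurableSet_Ioi] with x hx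
  have hx : 0 < x := hx
  rw [Real.norm_of_nonneg (by positivity)]
  exact div_le_self (Real.exp_pos _).le (one_le_pow₀ (by linarith))

lemma tendsto_exp_neg_mul_div_pow_atTop {s : ℝ} (hs : 0 < s) (m : ℕ) :
    Tendsto (fun x : ℝ => Real.exp (-s * x) / (1 + x) ^ m) atTop (𝓝 0) := by
  have h0 : Tendsto (fun x : ℝ => Real.exp (-s * x)) atTop (𝓝 0) :=
    Real.tendsto_exp_atBot.comp (tendsto_id.const_mul_atTop_of_neg (by linarith))
  refine tendsto_of_tendsto_of_tendsto_of_le_of_le' tendsto_const_nhds h0 ?_ ?_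
  · filter_upwards [eventually_ge_atTop 0] with x hx
    positivity
  · filter_upwards [eventually_ge_atTop 0] with x hx
    exact div_le_self (Real.exp_pos _).le (one_le_pow₀ (by linarith))

lemma hasDerivAt_exp_neg_mul_div_pow (s : ℝ) (m : ℕ) {x : ℝ} (hx : 0 ≤ x) :
    HasDerivAt (fun x : ℝ => Real.exp (-s * x) / (1 + x) ^ m)
      (-(s * (Real.exp (-s * x) / (1 + x) ^ m)
        + m * (Real.exp (-s * x) / (1 + x) ^ (m + 1)))) x := by
  have h1 : (1 + x) ≠ 0 := by positivity
  have he : HasDerivAt (fun x : ℝ => Real.exp (-s * x)) (Real.exp (-s * x) * (-s * 1)) x :=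
    ((hasDerivAt_id x).const_mul (-s)).exp
  have hp : HasDerivAt (fun x : ℝ => (1 + x) ^ m) (m * (1 + x) ^ (m - 1) * 1) x :=
    ((hasDerivAt_id x).const_add 1).pow m
  refine (he.div hp (pow_ne_zero m h1)).congr_deriv ?_
  rcases m with _ | m
  · simp; ring
  · simp only [Nat.add_sub_cancel]
    field_simp
    ring

/-- The functions `ψ(s, m)` are the generalized exponential integrals `∫₁^∞ e^(-s t) t^(-m) dt`,
here with `t = 1 + x`. -/
lemma integral_exp_neg_mul_div_pow {s : ℝ} (hs : 0 < s) {m : ℕ} (hm : 1 ≤ m) :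
    ∫ x in Set.Ioi (0 : ℝ), Real.exp (-s * x) / (1 + x) ^ m = Real.exp s * psi s m := by
  induction m, hm using Nat.le_induction with
  | base =>
    rw [psi_one, Ei_of_neg (neg_neg_of_pos hs), neg_neg, neg_neg]
    -- The substitution is `t = s (1 + x)`.
    have h1 := integral_comp_mul_left_Ioi (fun t : ℝ => Real.exp (-(t + s)) / (t + s)) 0 hs
    have h2 := (measurePreserving_add_right volume s).setIntegral_preimage_emb
      (measurableEmbedding_addRight s) (fun t : ℝ => Real.exp (-t) / t) (Set.Ioi s)
    rw [mul_zero] at h1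
    rw [Set.preimage_add_const_Ioi, sub_self] at h2
    rw [h2, smul_eq_mul] at h1
    rw [← mul_inv_cancel_left₀ hs.ne' (∫ t in Set.Ioi s, Real.exp (-t) / t), ← h1,
      ← integral_const_mul, ← integral_const_mul]
    refine setIntegral_congr_fun measurableSet_Ioi fun x hx => ?_
    have hx : 0 < x := hx
    have he : Real.exp (-s * x) = Real.exp s * Real.exp (-(s * x + s)) := by
      rw [← Real.exp_add]; congr 1; ring
    simp only [pow_one]
    rw [he]
    field_simp
    ring
  | succ m hm ih =>
    have hm0 : (m : ℝ) ≠ 0 := by positivity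
    have hI := (integrableOn_exp_neg_mul_div_pow hs m).const_mul s
    have hI' := (integrableOn_exp_neg_mul_div_pow hs (m + 1)).const_mul (m : ℝ)
    have hftc := integral_Ioi_of_hasDerivAt_of_tendsto' (a := 0)
      (fun x hx => hasDerivAt_exp_neg_mul_div_pow s m hx)
      (hI.add hI').neg (tendsto_exp_neg_mul_div_pow_atTop hs m)
    rw [integral_neg, integral_add hI hI', integral_const_mul, integral_const_mul, ih] at hftc
    have hrec := mul_psi_succ s hm
    have hexp : Real.exp s * Real.exp (-s) = 1 := by rw [← Real.exp_add]; simp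
    simp only [mul_zero, Real.exp_zero, add_zero, one_pow, div_one] at hftc
    apply mul_left_cancel₀ hm0
    rw [mul_left_comm, hrec, mul_sub, hexp]
    linarith

/-! ### The modulus of a complex Gaussian variable -/

instance isProbabilityMeasure_stdComplexGaussian : IsProbabilityMeasure stdComplexGaussian :=
  Measure.isProbabilityMeasure_map Complex.measurableEquivRealProd.symm.measurable.aemeasurable

instance isProbabilityMeasure_stdComplexGaussianVec (T : ℕ) :
    IsProbabilityMeasure (stdComplexGaussianVec T) := by
  unfold stdComplexGaussianVec; infer_instance

lemma lintegral_Ioi_mul_exp_neg_mul_sq {a c : ℝ} (ha : 0 ≤ a) (hc : 0 < c) :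
    ∫⁻ r in Set.Ioi a, ENNReal.ofReal (2 * r * Real.exp (-c * r ^ 2))
      = ENNReal.ofReal (Real.exp (-c * a ^ 2) / c) := by
  have hderiv : ∀ r ∈ Set.Ici a, HasDerivAt (fun r : ℝ => -Real.exp (-c * r ^ 2) / c)
      (2 * r * Real.exp (-c * r ^ 2)) r := by
    intro r _
    refine ((((hasDerivAt_id r).pow 2).const_mul (-c)).exp.neg.div_const c).congr_deriv ?_
    simp only [id]
    field_simp
    norm_num
    ring
  have hnn : ∀ r ∈ Set.Ioi a, 0 ≤ 2 * r * Real.exp (-c * r ^ 2) := fun r hr => by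
    have : 0 ≤ r := ha.trans (le_of_lt hr)
    positivity
  have hlim : Tendsto (fun r : ℝ => -Real.exp (-c * r ^ 2) / c) atTop (𝓝 0) := by
    have h : Tendsto (fun r : ℝ => Real.exp (-c * r ^ 2)) atTop (𝓝 0) :=
      Real.tendsto_exp_atBot.comp
        ((tendsto_pow_atTop two_ne_zero).const_mul_atTop_of_neg (by linarith))
    simpa using h.neg.div_const c
  have hint := integrableOn_Ioi_deriv_of_nonneg' hderiv hnn hlim
  rw [← ofReal_integral_eq_lintegral_ofReal hint
    ((ae_restrict_mem measurableSet_Ioi).mono fun r hr => hnn r hr),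
    integral_Ioi_of_hasDerivAt_of_nonneg' hderiv hnn hlim]
  congr 1
  ring

/-- Polar coordinates: for `z` of law `CN(0, 1)`, the modulus `‖z‖` has density
`2 r e^(-r²)` on `r > 0`. -/
lemma lintegral_norm_sq_stdComplexGaussian {f : ℝ → ℝ≥0∞} (hf : Measurable f) :
    ∫⁻ z, f (‖z‖ ^ 2) ∂stdComplexGaussian
      = ∫⁻ r in Set.Ioi (0 : ℝ), ENNReal.ofReal (2 * r * Real.exp (-1 * r ^ 2)) * f (r ^ 2) := by
  have hv : (1 / 2 : NNReal) ≠ 0 := by norm_num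
  have hpdf : ∀ a b : ℝ, gaussianPDF 0 (1 / 2) a * gaussianPDF 0 (1 / 2) b
      = ENNReal.ofReal (Real.pi⁻¹ * Real.exp (-(a ^ 2 + b ^ 2))) := by
    intro a b
    rw [gaussianPDF, gaussianPDF, ← ENNReal.ofReal_mul (gaussianPDFReal_nonneg _ _ _),
      gaussianPDFReal, gaussianPDFReal, mul_mul_mul_comm, ← Real.exp_add, ← mul_inv,
      Real.mul_self_sqrt (by positivity)]
    congr 3
    · push_cast
      ring
    · push_cast
      ring
  have hmeas : Measurable fun p : ℝ × ℝ =>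
      f (‖Complex.measurableEquivRealProd.symm p‖ ^ 2) :=
    hf.comp (Complex.measurableEquivRealProd.symm.measurable.norm.pow_const 2)
  rw [stdComplexGaussian, lintegral_map (f := fun z : ℂ => f (‖z‖ ^ 2))
    (hf.comp (measurable_norm.pow_const 2))
    Complex.measurableEquivRealProd.symm.measurable, gaussianReal_of_var_ne_zero 0 hv,
    prod_withDensity (measurable_gaussianPDF _ _) (measurable_gaussianPDF _ _),
    lintegral_withDensity_eq_lintegral_mul _ (by fun_prop) hmeas, ← Measure.volume_eq_prod,
    ← lintegral_comp_polarCoord_symm, polarCoord_target, Measure.volume_eq_prod,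
    ← Measure.prod_restrict]
  have hint : ∀ p : ℝ × ℝ, ENNReal.ofReal p.1 • ((fun z : ℝ × ℝ =>
        gaussianPDF 0 (1 / 2) z.1 * gaussianPDF 0 (1 / 2) z.2) * fun p : ℝ × ℝ =>
          f (‖Complex.measurableEquivRealProd.symm p‖ ^ 2)) (polarCoord.symm p)
      = ENNReal.ofReal p.1 * (ENNReal.ofReal (Real.pi⁻¹ * Real.exp (-p.1 ^ 2)) * f (p.1 ^ 2)) := by
    intro p
    have hsq : (p.1 * Real.cos p.2) ^ 2 + (p.1 * Real.sin p.2) ^ 2 = p.1 ^ 2 := by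
      rw [mul_pow, mul_pow, ← mul_add, Real.cos_sq_add_sin_sq, mul_one]
    have hnorm : ‖Complex.measurableEquivRealProd.symm (polarCoord.symm p)‖ ^ 2 = p.1 ^ 2 := by
      rw [Complex.measurableEquivRealProd_symm_polarCoord_symm_apply,
        Complex.norm_polarCoord_symm, sq_abs]
    simp only [Pi.mul_apply, smul_eq_mul]
    rw [hpdf, hnorm, polarCoord_symm_apply, hsq]
  simp_rw [hint]
  rw [lintegral_prod _ (by fun_prop)]
  simp only [lintegral_const, Measure.restrict_apply MeasurableSet.univ, Set.univ_inter,
    Real.volume_Ioo]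
  refine setLIntegral_congr_fun measurableSet_Ioi fun r hr => ?_
  have hr : 0 < r := hr
  rw [mul_right_comm, ← mul_assoc, ← ENNReal.ofReal_mul hr.le,
    ← ENNReal.ofReal_mul (mul_nonneg hr.le (by linarith [Real.pi_pos]))]
  congr 2
  have := Real.pi_ne_zero
  field_simp
  ring

/-- The squared modulus of a `CN(0, 1)` variable is exponential with rate one. -/
lemma stdComplexGaussian_lt_norm_sq {x : ℝ} (hx : 0 ≤ x) :
    stdComplexGaussian {z | x < ‖z‖ ^ 2} = ENNReal.ofReal (Real.exp (-x)) := by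
  have hset : MeasurableSet {z : ℂ | x < ‖z‖ ^ 2} :=
    measurableSet_lt measurable_const (measurable_norm.pow_const 2)
  have h := lintegral_norm_sq_stdComplexGaussian
    (measurable_const.indicator (measurableSet_Ioi (a := x)) : Measurable
      ((Set.Ioi x).indicator fun _ => (1 : ℝ≥0∞)))
  have h1 : ∀ z : ℂ, (Set.Ioi x).indicator (fun _ => (1 : ℝ≥0∞)) (‖z‖ ^ 2)
      = {z : ℂ | x < ‖z‖ ^ 2}.indicator 1 z := fun z => rfl
  simp_rw [h1] at h
  rw [lintegral_indicator_one hset] at h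
  rw [h, ← lintegral_indicator measurableSet_Ioi]
  have h2 := lintegral_Ioi_mul_exp_neg_mul_sq (Real.sqrt_nonneg x) one_pos
  rw [← lintegral_indicator measurableSet_Ioi, Real.sq_sqrt hx, div_one, neg_one_mul] at h2
  rw [← h2]
  refine lintegral_congr fun r => ?_
  by_cases hr : 0 < r
  · by_cases hxr : x < r ^ 2
    · have : Real.sqrt x < r := (Real.sqrt_lt' hr).2 hxr
      simp [Set.indicator, hr, hxr, this]
    · have : ¬ Real.sqrt x < r := fun h => hxr ((Real.sqrt_lt' hr).1 h)
      simp [Set.indicator, hxr, this]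
  · have : ¬ Real.sqrt x < r := fun h => hr ((Real.sqrt_nonneg x).trans_lt h)
    simp [Set.indicator, hr, this]

lemma lintegral_exp_neg_mul_norm_sq {x : ℝ} (hx : 0 ≤ x) :
    ∫⁻ z, ENNReal.ofReal (Real.exp (-(x * ‖z‖ ^ 2))) ∂stdComplexGaussian
      = ENNReal.ofReal ((1 + x)⁻¹) := by
  rw [lintegral_norm_sq_stdComplexGaussian
    (f := fun y => ENNReal.ofReal (Real.exp (-(x * y)))) (by fun_prop)]
  have h := lintegral_Ioi_mul_exp_neg_mul_sq le_rfl (show 0 < 1 + x by linarith)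
  rw [← one_div]
  simp only [ne_eq, OfNat.ofNat_ne_zero, not_false_eq_true, zero_pow, mul_zero,
    Real.exp_zero] at h
  rw [← h]
  refine setLIntegral_congr_fun measurableSet_Ioi fun r hr => ?_
  have hr : 0 < r := hr
  rw [← ENNReal.ofReal_mul (by positivity), mul_assoc, ← Real.exp_add]
  congr 3
  ring

/-! ### Unitary invariance -/

lemma charFun_stdComplexGaussian (t : ℂ) :
    charFun stdComplexGaussian t = Complex.exp (-(‖t‖ ^ 2 / 4 : ℝ)) := by
  have hint : ∀ p : ℝ × ℝ,
      Complex.exp ((inner ℝ (Complex.measurableEquivRealProd.symm p) t : ℝ) * Complex.I)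
        = Complex.exp (t.re * p.1 * Complex.I) * Complex.exp (t.im * p.2 * Complex.I) := by
    intro p
    rw [← Complex.exp_add, Complex.inner]
    congr 1
    simp
    ring
  rw [charFun_apply, stdComplexGaussian, integral_map_equiv]
  simp_rw [hint]
  rw [integral_prod_mul (fun a : ℝ => Complex.exp (t.re * a * Complex.I))
    (fun b : ℝ => Complex.exp (t.im * b * Complex.I)), ← charFun_apply_real, ← charFun_apply_real,
    charFun_gaussianReal, charFun_gaussianReal, ← Complex.exp_add, Complex.sq_norm,
    Complex.normSq_apply]
  congr 1
  push_cast
  ring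

lemma charFun_stdComplexGaussianVec {N : ℕ} (t : EuclideanSpace ℂ (Fin N)) :
    charFun ((stdComplexGaussianVec N).map
      (WithLp.toLp 2 : (Fin N → ℂ) → EuclideanSpace ℂ (Fin N))) t
      = Complex.exp (-((∑ m, ‖t m‖ ^ 2) / 4 : ℝ)) := by
  have h := charFun_pi (μ := fun _ : Fin N => stdComplexGaussian) t
  simp_rw [charFun_stdComplexGaussian] at h
  rw [← Complex.exp_sum] at h
  refine h.trans ?_
  congr 1
  push_cast
  rw [Finset.sum_neg_distrib, Finset.sum_div]

/-- Unitary invariance of the standard complex Gaussian law, up to a conjugation: if the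
columns of `w` are orthonormal, the inner products `vᴴ w_m` of a `CN(0, I)` vector `v` with them
are again independent with law `CN(0, 1)`. -/
lemma map_star_dotProduct_col_stdComplexGaussianVec {T N : ℕ} {w : Matrix (Fin T) (Fin N) ℂ}
    (hw : wᴴ * w = 1) :
    (stdComplexGaussianVec T).map (fun v m => star v ⬝ᵥ w.col m) = stdComplexGaussianVec N := by
  have hA : Continuous fun (v : Fin T → ℂ) (m : Fin N) => star v ⬝ᵥ w.col m := by
    simp only [dotProduct, Pi.star_apply]; fun_prop
  have : IsProbabilityMeasure
      ((stdComplexGaussianVec T).map fun v (m : Fin N) => star v ⬝ᵥ w.col m) :=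
    Measure.isProbabilityMeasure_map hA.measurable.aemeasurable
  refine (charFun_eq_pi_iff (μ := fun _ : Fin N => stdComplexGaussian)).1 fun t => ?_
  -- The real adjoint of the conjugate-linear map `v ↦ (vᴴ w_m)_m` sends `t` to `w *ᵥ star t`, and this
  -- vector has the same norm as `t`.
  set u : Fin N → ℂ := star (WithLp.ofLp t)
  set s : EuclideanSpace ℂ (Fin T) := WithLp.toLp 2 (w *ᵥ u) with hs
  have hinner : ∀ v : Fin T → ℂ,
      inner ℝ (WithLp.toLp 2 (fun m => star v ⬝ᵥ w.col m) : PiLp 2 fun _ : Fin N => ℂ) t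
        = inner ℝ (WithLp.toLp 2 v : PiLp 2 fun _ : Fin T => ℂ) s := by
    intro v
    simp only [PiLp.inner_apply, Complex.inner]
    rw [← Complex.re_sum, ← Complex.re_sum, ← Complex.conj_re]
    congr 1
    simp only [hs, u, dotProduct, Matrix.mulVec, map_sum, map_mul, Finset.sum_mul, Finset.mul_sum,
      Pi.star_apply, Matrix.col_apply, Complex.conj_conj, RCLike.star_def]
    rw [Finset.sum_comm]
    refine Finset.sum_congr rfl fun τ _ => Finset.sum_congr rfl fun m _ => ?_
    ring
  have hnorm : ∀ {n : ℕ} (x : Fin n → ℂ), ((∑ m, ‖x m‖ ^ 2 : ℝ) : ℂ) = star x ⬝ᵥ x := by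
    intro n x
    simp only [dotProduct, Pi.star_apply, RCLike.star_def, Complex.conj_mul']
    push_cast
    rfl
  have hsum : ∑ τ, ‖s τ‖ ^ 2 = ∑ m, ‖t m‖ ^ 2 := by
    have h1 : ∑ m, ‖t m‖ ^ 2 = ∑ m, ‖u m‖ ^ 2 := by simp [u]
    rw [h1]
    apply Complex.ofReal_injective
    rw [hnorm, hnorm, hs, Matrix.star_mulVec, Matrix.dotProduct_mulVec, Matrix.vecMul_vecMul, hw,
      Matrix.vecMul_one]
  rw [← charFun_pi (μ := fun _ : Fin N => stdComplexGaussian)]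
  refine Eq.trans ?_ (charFun_stdComplexGaussianVec t).symm
  rw [← hsum, ← charFun_stdComplexGaussianVec, charFun_apply, charFun_apply,
    ← MeasurableEquiv.coe_toLp, ← MeasurableEquiv.coe_toLp, integral_map_equiv,
    integral_map_equiv, integral_map hA.measurable.aemeasurable (by fun_prop)]
  simp_rw [MeasurableEquiv.coe_toLp, hinner]

/-! ### The law of the signal to interference and noise ratio -/

/-- Fubini for the comparison of two independent random variables. -/
lemma ProbabilityTheory.IndepFun.measure_lt {Ω : Type*} [MeasurableSpace Ω] {μ : Measure Ω}
    [IsProbabilityMeasure μ] {X Y : Ω → ℝ} (h : IndepFun X Y μ) (hX : Measurable X)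
    (hY : Measurable Y) {φ : ℝ → ℝ} (hφ : Measurable φ) :
    μ {ω | φ (X ω) < Y ω} = ∫⁻ ω, μ {ω' | φ (X ω) < Y ω'} ∂μ := by
  have hE : MeasurableSet {p : ℝ × ℝ | φ p.1 < p.2} :=
    measurableSet_lt (hφ.comp measurable_fst) measurable_snd
  have h1 : μ {ω | φ (X ω) < Y ω} = (μ.map fun ω => (X ω, Y ω)) {p : ℝ × ℝ | φ p.1 < p.2} := by
    rw [Measure.map_apply (hX.prodMk hY) hE]; rfl
  rw [h1, h.map_prod_eq_prod_map_map hX.aemeasurable hY.aemeasurable, Measure.prod_apply hE,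
    lintegral_map (measurable_measure_prodMk_left hE) hX]
  refine lintegral_congr fun ω => ?_
  rw [Measure.map_apply hY (measurable_prodMk_left hE)]
  rfl

/-- The quotient `c ‖z_k‖² / (c ∑_{m > k} ‖z_m‖² + σ²)`: the signal to interference and noise ratio
of a user whose effective channel gains are `√c z_m`. -/
noncomputable def gainRatio {N : ℕ} (c σ : ℝ) (k : Fin N) (z : Fin N → ℂ) : ℝ :=
  c * ‖z k‖ ^ 2 / (c * ∑ m ∈ Finset.Ioi k, ‖z m‖ ^ 2 + σ ^ 2)

lemma sinr_channel_eq_gainRatio {N T : ℕ} {d : Fin N → ℝ} (γ : ℝ) (g : Fin N → Fin T → ℂ)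
    (W : Matrix (Fin T) (Fin N) ℂ) (σ : ℝ) {i : Fin N} (hd : 0 < d i) (k : Fin N) :
    sinr (channel d γ g) W σ i k
      = gainRatio (d i ^ (-γ)) σ k (fun m => star (g i) ⬝ᵥ W.col m) := by
  have h : ∀ m, ‖star (channel d γ g i) ⬝ᵥ W.col m‖ ^ 2
      = d i ^ (-γ) * ‖star (g i) ⬝ᵥ W.col m‖ ^ 2 := by
    intro m
    have hs : channel d γ g i = (Real.sqrt (d i ^ (-γ)) : ℂ) • g i := rfl
    rw [hs, star_smul, smul_dotProduct, norm_smul, mul_pow, norm_star, Complex.norm_real,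
      Real.norm_eq_abs, sq_abs, Real.sq_sqrt (Real.rpow_pos_of_pos hd _).le]
  rw [sinr, gainRatio, h, Finset.mul_sum]
  simp_rw [h]

lemma gainRatio_nonneg {N : ℕ} {c : ℝ} (hc : 0 ≤ c) (σ : ℝ) (k : Fin N) (z : Fin N → ℂ) :
    0 ≤ gainRatio c σ k z := by
  unfold gainRatio; positivity

lemma measurable_gainRatio {N : ℕ} (c σ : ℝ) (k : Fin N) :
    Measurable (gainRatio c σ k) := by
  unfold gainRatio; fun_prop

/-- The tail of the signal to interference and noise ratio. Given the interference `S`, the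
signal exceeds the threshold with probability `e^(-x (S + σ²/c))`; averaging over `S` contributes a
factor `E e^(-x ‖z_m‖²) = 1 / (1 + x)` for each interfering column. -/
lemma stdComplexGaussianVec_lt_gainRatio {N : ℕ} {c σ : ℝ} (hc : 0 < c) (hσ : 0 < σ) (k : Fin N)
    {x : ℝ} (hx : 0 ≤ x) :
    stdComplexGaussianVec N {z | x < gainRatio c σ k z}
      = ENNReal.ofReal (Real.exp (-(c⁻¹ * σ ^ 2) * x) / (1 + x) ^ (N - (k + 1) : ℕ)) := by
  have hind : iIndepFun (fun (m : Fin N) (z : Fin N → ℂ) => ‖z m‖ ^ 2)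
      (stdComplexGaussianVec N) :=
    iIndepFun_pi (X := fun (_ : Fin N) (z : ℂ) => ‖z‖ ^ 2) fun _ => by fun_prop
  have hS := hind.indepFun_finsetSum_of_notMem (fun m => by fun_prop)
    (s := Finset.Ioi k) (i := k) (by simp)
  have heval : ∀ m : Fin N, MeasurePreserving (Function.eval m) (stdComplexGaussianVec N)
      stdComplexGaussian := measurePreserving_eval fun _ : Fin N => stdComplexGaussian
  have hset : {z : Fin N → ℂ | x < gainRatio c σ k z}
      = {z | x * ((∑ m ∈ Finset.Ioi k, fun z : Fin N → ℂ => ‖z m‖ ^ 2) z + c⁻¹ * σ ^ 2)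
          < ‖z k‖ ^ 2} := by
    ext z
    have hden : 0 < c * ∑ m ∈ Finset.Ioi k, ‖z m‖ ^ 2 + σ ^ 2 := by positivity
    rw [Set.mem_ofPred_eq, Set.mem_ofPred_eq, gainRatio, lt_div_iff₀ hden, Finset.sum_apply]
    have hsplit : c * (x * (∑ m ∈ Finset.Ioi k, ‖z m‖ ^ 2 + c⁻¹ * σ ^ 2))
        = x * (c * ∑ m ∈ Finset.Ioi k, ‖z m‖ ^ 2 + σ ^ 2) := by field_simp
    rw [← hsplit]
    exact mul_lt_mul_iff_right₀ hc
  rw [hset, hS.measure_lt (φ := fun s => x * (s + c⁻¹ * σ ^ 2)) (by fun_prop) (by fun_prop)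
    (by fun_prop)]
  have htail : ∀ z : Fin N → ℂ, stdComplexGaussianVec N {z' |
        x * ((∑ m ∈ Finset.Ioi k, fun z : Fin N → ℂ => ‖z m‖ ^ 2) z + c⁻¹ * σ ^ 2) < ‖z' k‖ ^ 2}
      = ENNReal.ofReal (Real.exp (-(c⁻¹ * σ ^ 2) * x))
        * ∏ m ∈ Finset.Ioi k, ENNReal.ofReal (Real.exp (-(x * ‖z m‖ ^ 2))) := by
    intro z
    have hnn : 0 ≤ x * ((∑ m ∈ Finset.Ioi k, fun z : Fin N → ℂ => ‖z m‖ ^ 2) z + c⁻¹ * σ ^ 2) := by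
      rw [Finset.sum_apply]; positivity
    have := (heval k).measure_preimage
      (measurableSet_lt measurable_const (measurable_norm.pow_const 2)).nullMeasurableSet
      (s := {y : ℂ | x * ((∑ m ∈ Finset.Ioi k, fun z : Fin N → ℂ => ‖z m‖ ^ 2) z
        + c⁻¹ * σ ^ 2) < ‖y‖ ^ 2})
    refine this.trans ?_
    rw [stdComplexGaussian_lt_norm_sq hnn, ← ENNReal.ofReal_prod_of_nonneg
      fun _ _ => (Real.exp_pos _).le, ← Real.exp_sum, ← ENNReal.ofReal_mul (Real.exp_pos _).le,
      ← Real.exp_add, Finset.sum_apply, Finset.sum_neg_distrib, ← Finset.mul_sum]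
    congr 2
    ring
  simp_rw [htail]
  rw [lintegral_const_mul _ (by fun_prop), lintegral_prod_eq_prod_lintegral_of_indepFun _
    (fun (m : Fin N) (z : Fin N → ℂ) => ENNReal.ofReal (Real.exp (-(x * ‖z m‖ ^ 2))))
    (hind.comp (fun _ s => ENNReal.ofReal (Real.exp (-(x * s)))) fun _ => by fun_prop)
    fun _ => by fun_prop]
  have hmgf : ∀ m : Fin N, ∫⁻ z, ENNReal.ofReal (Real.exp (-(x * ‖z m‖ ^ 2)))
      ∂stdComplexGaussianVec N = ENNReal.ofReal ((1 + x)⁻¹) := fun m =>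
    ((heval m).lintegral_comp (f := fun y : ℂ => ENNReal.ofReal (Real.exp (-(x * ‖y‖ ^ 2))))
      (by fun_prop)).trans (lintegral_exp_neg_mul_norm_sq hx)
  simp_rw [hmgf]
  rw [Finset.prod_const, Fin.card_Ioi, ← ENNReal.ofReal_pow (by positivity),
    ← ENNReal.ofReal_mul (Real.exp_pos _).le, inv_pow, div_eq_mul_inv, Nat.sub_sub,
    add_comm 1 (k : ℕ)]

/-! ### Comparison of two users -/

/-- Comparison of two independent nonnegative variables with tails `e^(-a x) (1 + x)^(-n)` and
`e^(-b x) (1 + x)^(-n)`. By the layer cake formula, with `q` the density of `X`,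
`Pr (X ≤ Y) = E ∫₀^Y q = ∫₀^∞ Pr (Y > x) q x dx`. -/
lemma prod_real_lt_of_tails {α β : Type*} [MeasurableSpace α] [MeasurableSpace β] {μ : Measure α}
    {ν : Measure β} [IsProbabilityMeasure μ] [IsProbabilityMeasure ν] {X : α → ℝ} {Y : β → ℝ}
    (hX : Measurable X) (hY : Measurable Y) (hY0 : ∀ y, 0 ≤ Y y) {a b : ℝ} (ha : 0 < a)
    (hb : 0 < b) {n : ℕ} (hn : 1 ≤ n)
    (htX : ∀ x, 0 ≤ x → μ {ω | x < X ω} = ENNReal.ofReal (Real.exp (-a * x) / (1 + x) ^ n))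
    (htY : ∀ x, 0 ≤ x → ν {ω | x < Y ω} = ENNReal.ofReal (Real.exp (-b * x) / (1 + x) ^ n)) :
    (μ.prod ν).real {p | Y p.2 < X p.1}
      = 1 - Real.exp (a + b) * a * psi (a + b) (2 * n)
        - Real.exp (a + b) * n * psi (a + b) (2 * n + 1) := by
  have hab : 0 < a + b := add_pos ha hb
  set q : ℝ → ℝ := fun x => a * (Real.exp (-a * x) / (1 + x) ^ n)
    + n * (Real.exp (-a * x) / (1 + x) ^ (n + 1)) with hq
  have hq0 : ∀ x, 0 ≤ x → 0 ≤ q x := fun x hx => by simp only [hq]; positivity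
  have hq_int : ∀ t, 0 ≤ t → IntervalIntegrable q volume 0 t := by
    intro t ht
    refine ContinuousOn.intervalIntegrable fun x hx => ContinuousAt.continuousWithinAt ?_
    rw [Set.uIcc_of_le ht] at hx
    have : (1 + x) ≠ 0 := by linarith [hx.1]
    simp only [hq]
    fun_prop (disch := exact pow_ne_zero _ this)
  have hq_ftc : ∀ t, 0 ≤ t → ∫ x in (0 : ℝ)..t, q x = 1 - Real.exp (-a * t) / (1 + t) ^ n := by
    intro t ht
    have h := intervalIntegral.integral_eq_sub_of_hasDerivAt
      (f := fun x => -(Real.exp (-a * x) / (1 + x) ^ n)) (f' := q) (a := 0) (b := t)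
      (fun x hx => ?_) (hq_int t ht)
    · rw [h]; simp; ring
    · rw [Set.uIcc_of_le ht] at hx
      exact (hasDerivAt_exp_neg_mul_div_pow a n hx.1).neg.congr_deriv (neg_neg _)
  have htail_le : ∀ t, 0 ≤ t → Real.exp (-a * t) / (1 + t) ^ n ≤ 1 := by
    intro t ht
    refine div_le_one_of_le₀ ?_ (by positivity)
    exact (Real.exp_le_one_iff.2 (by nlinarith)).trans (one_le_pow₀ (by linarith))
  have hE : MeasurableSet {p : α × β | Y p.2 < X p.1} :=
    measurableSet_lt (hY.comp measurable_snd) (hX.comp measurable_fst)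
  have hfub : (μ.prod ν) {p | Y p.2 < X p.1}
      = ∫⁻ y, (1 - ENNReal.ofReal (∫ x in (0 : ℝ)..Y y, q x)) ∂ν := by
    rw [Measure.prod_apply_symm hE]
    refine lintegral_congr fun y => ?_
    refine (htX (Y y) (hY0 y)).trans ?_
    rw [hq_ftc _ (hY0 y), ← ENNReal.ofReal_one,
      ← ENNReal.ofReal_sub _ (sub_nonneg.2 (htail_le _ (hY0 y))), sub_sub_cancel]
  have hle : ∀ y, ENNReal.ofReal (∫ x in (0 : ℝ)..Y y, q x) ≤ 1 := fun y => by
    rw [hq_ftc _ (hY0 y), ENNReal.ofReal_le_one]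
    have := hY0 y
    have : 0 ≤ Real.exp (-a * Y y) / (1 + Y y) ^ n := by positivity
    linarith
  have hmeas : Measurable fun y => ENNReal.ofReal (∫ x in (0 : ℝ)..Y y, q x) := by
    simp_rw [fun y => hq_ftc _ (hY0 y)]
    fun_prop
  have hcake : ∫⁻ y, ENNReal.ofReal (∫ x in (0 : ℝ)..Y y, q x) ∂ν
      = ENNReal.ofReal (Real.exp (a + b) * a * psi (a + b) (2 * n)
        + Real.exp (a + b) * n * psi (a + b) (2 * n + 1)) := by
    rw [lintegral_comp_eq_lintegral_meas_lt_mul ν (ae_of_all _ hY0) hY.aemeasurable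
      (fun t ht => hq_int t ht.le)
      ((ae_restrict_mem measurableSet_Ioi).mono fun x hx => hq0 x (le_of_lt hx))]
    have hI := (integrableOn_exp_neg_mul_div_pow hab (2 * n)).const_mul a
    have hI' := (integrableOn_exp_neg_mul_div_pow hab (2 * n + 1)).const_mul (n : ℝ)
    have hval : ∫ x in Set.Ioi (0 : ℝ), (a * (Real.exp (-(a + b) * x) / (1 + x) ^ (2 * n))
          + n * (Real.exp (-(a + b) * x) / (1 + x) ^ (2 * n + 1)))
        = Real.exp (a + b) * a * psi (a + b) (2 * n)
          + Real.exp (a + b) * n * psi (a + b) (2 * n + 1) := by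
      rw [integral_add hI hI', integral_const_mul, integral_const_mul,
        integral_exp_neg_mul_div_pow hab (by omega), integral_exp_neg_mul_div_pow hab (by omega)]
      ring
    rw [← hval, ofReal_integral_eq_lintegral_ofReal
      (f := fun x => a * (Real.exp (-(a + b) * x) / (1 + x) ^ (2 * n))
          + n * (Real.exp (-(a + b) * x) / (1 + x) ^ (2 * n + 1))) (hI.add hI')
      ((ae_restrict_mem measurableSet_Ioi).mono fun x hx => ?_)]
    · refine setLIntegral_congr_fun measurableSet_Ioi fun x hx => ?_
      have hx : 0 < x := hx
      have he : Real.exp (-(a + b) * x) = Real.exp (-b * x) * Real.exp (-a * x) := by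
        rw [← Real.exp_add]; congr 1; ring
      simp only [htY x hx.le]
      rw [← ENNReal.ofReal_mul (by positivity), he]
      congr 1
      simp only [hq]
      field_simp
      ring
    · have hx : 0 < x := hx
      simp only [Pi.zero_apply]
      positivity
  have hcake_le : ∫⁻ y, ENNReal.ofReal (∫ x in (0 : ℝ)..Y y, q x) ∂ν ≤ 1 :=
    (lintegral_mono hle).trans (by simp)
  have hnn : 0 ≤ Real.exp (a + b) * a * psi (a + b) (2 * n)
        + Real.exp (a + b) * n * psi (a + b) (2 * n + 1) := by
    have h : ∀ m : ℕ, 1 ≤ m → 0 ≤ Real.exp (a + b) * psi (a + b) m := fun m hm => by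
      rw [← integral_exp_neg_mul_div_pow hab hm]
      refine setIntegral_nonneg measurableSet_Ioi fun x hx => ?_
      have hx : 0 < x := hx
      positivity
    rw [mul_right_comm, mul_right_comm _ (n : ℝ)]
    exact add_nonneg (mul_nonneg (h _ (by omega)) ha.le)
      (mul_nonneg (h _ (by omega)) (Nat.cast_nonneg n))
  rw [Measure.real, hfub, lintegral_sub hmeas (ne_top_of_le_ne_top ENNReal.one_ne_top hcake_le)
    (ae_of_all _ hle), lintegral_const, measure_univ, one_mul,
    ENNReal.toReal_sub_of_le hcake_le ENNReal.one_ne_top, hcake, ENNReal.toReal_ofReal hnn,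
    ENNReal.toReal_one]
  ring

lemma measurable_star_dotProduct_col (T N : ℕ) :
    Measurable fun (p : Matrix (Fin T) (Fin N) ℂ × (Fin T → ℂ)) (m : Fin N) =>
      star p.2 ⬝ᵥ p.1.col m := by
  have hent : ∀ (t : Fin T) (m : Fin N),
      Measurable fun w : Matrix (Fin T) (Fin N) ℂ => w t m := fun t m =>
    (measurable_pi_apply m).comp (measurable_pi_apply t)
  refine measurable_pi_lambda _ fun m => ?_
  simp only [dotProduct, Pi.star_apply, Matrix.col_apply, RCLike.star_def]
  refine Finset.measurable_sum _ fun t _ => Measurable.mul ?_ ((hent t m).comp measurable_fst)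
  exact Complex.continuous_conj.measurable.comp
    ((measurable_pi_apply t).comp measurable_snd)

lemma measurable_gainRatio_star_dotProduct_col {T N : ℕ} (c σ : ℝ) (k : Fin N) :
    Measurable fun p : Matrix (Fin T) (Fin N) ℂ × (Fin T → ℂ) =>
      gainRatio c σ k fun m => star p.2 ⬝ᵥ p.1.col m :=
  (measurable_gainRatio c σ k).comp (measurable_star_dotProduct_col T N)

lemma measurableSet_gainRatio_lt {T N : ℕ} (c₁ c₂ σ : ℝ) (k : Fin N) :
    MeasurableSet {p : Matrix (Fin T) (Fin N) ℂ × ((Fin T → ℂ) × (Fin T → ℂ)) |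
      gainRatio c₂ σ k (fun m => star p.2.2 ⬝ᵥ p.1.col m)
        < gainRatio c₁ σ k (fun m => star p.2.1 ⬝ᵥ p.1.col m)} := by
  have hp₁ : Measurable fun p : Matrix (Fin T) (Fin N) ℂ × ((Fin T → ℂ) × (Fin T → ℂ)) =>
      (p.1, p.2.1) := measurable_fst.prodMk (measurable_fst.comp measurable_snd)
  have hp₂ : Measurable fun p : Matrix (Fin T) (Fin N) ℂ × ((Fin T → ℂ) × (Fin T → ℂ)) =>
      (p.1, p.2.2) := measurable_fst.prodMk (measurable_snd.comp measurable_snd)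
  have h₁ : Measurable fun p : Matrix (Fin T) (Fin N) ℂ × ((Fin T → ℂ) × (Fin T → ℂ)) =>
      gainRatio c₁ σ k fun m => star p.2.1 ⬝ᵥ p.1.col m := by
    simpa only [Function.comp_def] using
      (measurable_gainRatio_star_dotProduct_col c₁ σ k).comp hp₁
  have h₂ : Measurable fun p : Matrix (Fin T) (Fin N) ℂ × ((Fin T → ℂ) × (Fin T → ℂ)) =>
      gainRatio c₂ σ k fun m => star p.2.2 ⬝ᵥ p.1.col m := by
    simpa only [Function.comp_def] using
      (measurable_gainRatio_star_dotProduct_col c₂ σ k).comp hp₂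
  exact measurableSet_lt h₂ h₁

/-- The comparison of two users for a fixed precoding matrix `w` with orthonormal columns. The
result does not depend on `w`. -/
lemma prod_real_gainRatio_lt {T N : ℕ} {w : Matrix (Fin T) (Fin N) ℂ} (hw : wᴴ * w = 1)
    {c₁ c₂ σ : ℝ} (hc₁ : 0 < c₁) (hc₂ : 0 < c₂) (hσ : 0 < σ) {k : Fin N}
    (hk : (k : ℕ) + 1 < N) :
    ((stdComplexGaussianVec T).prod (stdComplexGaussianVec T)).real
        {p | gainRatio c₂ σ k (fun m => star p.2 ⬝ᵥ w.col m)
          < gainRatio c₁ σ k (fun m => star p.1 ⬝ᵥ w.col m)}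
      = 1
        - Real.exp ((c₁⁻¹ + c₂⁻¹) * σ ^ 2) * (c₁⁻¹ * σ ^ 2)
          * psi ((c₁⁻¹ + c₂⁻¹) * σ ^ 2) (2 * (N - (k + 1)))
        - Real.exp ((c₁⁻¹ + c₂⁻¹) * σ ^ 2) * ((N - (k + 1) : ℕ) : ℝ)
          * psi ((c₁⁻¹ + c₂⁻¹) * σ ^ 2) (2 * (N - (k + 1)) + 1) := by
  have hA : Measurable fun (v : Fin T → ℂ) (m : Fin N) => star v ⬝ᵥ w.col m :=
    (measurable_star_dotProduct_col T N).comp measurable_prodMk_left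
  have htail : ∀ c : ℝ, 0 < c → ∀ x : ℝ, 0 ≤ x →
      stdComplexGaussianVec T {v | x < gainRatio c σ k (fun m => star v ⬝ᵥ w.col m)}
        = ENNReal.ofReal (Real.exp (-(c⁻¹ * σ ^ 2) * x) / (1 + x) ^ (N - (k + 1) : ℕ)) := by
    intro c hc x hx
    rw [← stdComplexGaussianVec_lt_gainRatio hc hσ k hx,
      ← map_star_dotProduct_col_stdComplexGaussianVec hw, Measure.map_apply hA
        (measurableSet_lt measurable_const (measurable_gainRatio _ _ _))]
    rfl
  rw [add_mul]
  exact prod_real_lt_of_tails ((measurable_gainRatio _ _ _).comp hA)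
    ((measurable_gainRatio _ _ _).comp hA) (fun v => gainRatio_nonneg hc₂.le _ _ _)
    (by positivity) (by positivity) (by omega) (htail c₁ hc₁) (htail c₂ hc₂)

/-- If a random element `W` is independent of `Z` and almost every section of an event for `(W, Z)`
has probability `r`, then the event has probability `r`. -/
lemma ProbabilityTheory.IndepFun.measureReal_of_sections {Ω α β : Type*} [MeasurableSpace Ω]
    [MeasurableSpace α] [MeasurableSpace β] {P : Measure Ω} [IsProbabilityMeasure P]
    {W : Ω → α} {Z : Ω → β} (h : IndepFun W Z P) (hW : AEMeasurable W P) (hZ : AEMeasurable Z P)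
    {E : Set (α × β)} (hE : MeasurableSet E) {r : ℝ}
    (hr : ∀ᵐ ω ∂P, (P.map Z).real {z | (W ω, z) ∈ E} = r) :
    P.real {ω | (W ω, Z ω) ∈ E} = r := by
  have : IsProbabilityMeasure (P.map Z) := Measure.isProbabilityMeasure_map hZ
  have hP : P {ω | (W ω, Z ω) ∈ E} = ENNReal.ofReal r := by
    have hmap : P {ω | (W ω, Z ω) ∈ E} = P.map (fun ω => (W ω, Z ω)) E :=
      (Measure.map_apply_of_aemeasurable (hW.prodMk hZ) hE).symm
    rw [hmap, h.map_prod_eq_prod_map_map hW hZ, Measure.prod_apply hE,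
      lintegral_map' (measurable_measure_prodMk_left hE).aemeasurable hW]
    refine (lintegral_congr_ae (hr.mono fun ω hω => ?_)).trans
      ((lintegral_const _).trans (by rw [measure_univ, mul_one]))
    rw [← hω, ofReal_measureReal]
    rfl
  obtain ⟨ω, hω⟩ := hr.exists
  rw [Measure.real, hP, ENNReal.toReal_ofReal (hω ▸ measureReal_nonneg)]

/-! ### The ordering probability -/

/-- The users and columns `1, …, N` are the elements `0, …, N - 1` of `Fin N`, so the
number `N - k` of interfering columns `m > k` reads `N - (k + 1)`, and `k ≤ N - 1` reads
`k + 1 < N`. -/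
theorem lemma2 {Ω : Type*} [MeasurableSpace Ω] (P : Measure Ω) [IsProbabilityMeasure P]
    (N T : ℕ) (d : Fin N → ℝ) (hd : ∀ i, 0 < d i) (γ σ : ℝ) (hσ : 0 < σ)
    (g : Fin N → Ω → Fin T → ℂ)
    (hg_law : ∀ i, HasLaw (g i) (stdComplexGaussianVec T) P)
    (hg_indep : iIndepFun g P)
    (W : Ω → Matrix (Fin T) (Fin N) ℂ) (hW_meas : AEMeasurable W P)
    (hW_unitary : ∀ᵐ ω ∂P, (W ω)ᴴ * W ω = 1)
    (hW_indep : IndepFun W (fun ω i => g i ω) P)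
    (lam : Fin N → ℝ) (hlam : ∀ i, lam i = d i ^ γ)
    (i j k : Fin N) (hij : j < i) (hk : (k : ℕ) + 1 < N) :
    P.real {ω | sinr (channel d γ fun u => g u ω) (W ω) σ i k
        > sinr (channel d γ fun u => g u ω) (W ω) σ j k}
      = 1
        - Real.exp ((lam i + lam j) * σ ^ 2) * (lam i * σ ^ 2)
          * psi ((lam i + lam j) * σ ^ 2) (2 * (N - (k + 1)))
        - Real.exp ((lam i + lam j) * σ ^ 2) * ((N - (k + 1) : ℕ) : ℝ)
          * psi ((lam i + lam j) * σ ^ 2) (2 * (N - (k + 1)) + 1) := by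
  have hc : ∀ u, 0 < d u ^ (-γ) := fun u => Real.rpow_pos_of_pos (hd u) _
  -- `λ_u = 1 / c_u`, where `c_u = d_u^(-γ)` is the mean of the exponential signal power.
  have hcinv : ∀ u, (d u ^ (-γ))⁻¹ = lam u := fun u => by
    rw [Real.rpow_neg (hd u).le, inv_inv, hlam]
  have hgm : ∀ u, AEMeasurable (g u) P := fun u => (hg_law u).aemeasurable
  have hpair : P.map (fun ω => (g i ω, g j ω))
      = (stdComplexGaussianVec T).prod (stdComplexGaussianVec T) := by
    rw [(hg_indep.indepFun hij.ne').map_prod_eq_prod_map_map (hgm i) (hgm j), (hg_law i).map_eq,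
      (hg_law j).map_eq]
  have hWpair : IndepFun W (fun ω => (g i ω, g j ω)) P :=
    hW_indep.comp (φ := id) (ψ := fun G : Fin N → Fin T → ℂ => (G i, G j)) measurable_id
      ((measurable_pi_apply i).prodMk (measurable_pi_apply j))
  -- The SINR of user `u` depends on `g_u` and `W` only, so the pair `(g_i, g_j)` is all that enters.
  simp only [gt_iff_lt, sinr_channel_eq_gainRatio _ _ _ _ (hd _)]
  refine hWpair.measureReal_of_sections hW_meas ((hgm i).prodMk (hgm j))
    (measurableSet_gainRatio_lt _ _ σ k) ?_
  filter_upwards [hW_unitary] with ω hω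
  rw [hpair, ← hcinv, ← hcinv]
  exact prod_real_gainRatio_lt hω (hc i) (hc j) hσ hk
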